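/- For a multi-index $(s_1,\dots,s_r)$ of positive integers with $s_1>1$, let $$\zeta^\star(s_1,\dots,s_r)=\sum_{k_1\ge k_2\ge\cdots\ge k_r\ge 1}\frac{1}{k_1^{s_1}\cdots k_r^{s_r}}$$ (the sum being over positive integers) denote the multiple zeta star value, with $\zeta^\star(\emptyset)=1$, and let $\{3,1\}^d$ denote the sequence $3,1$ repeated $d$ times. Then for every $z\in\mathbb{C}$ with $|z|<1$, $$\sum_{d=0}^{\infty}\zeta^\star(\{3,1\}^d)\,z^{4d}-\sum_{d=0}^{\infty}\zeta^\star(\{3,1\}^d,2)\,z^{4d+2}=\tanh(\pi z/2)\cdot\cot(\pi z/2),$$ where all the series involved (those defining the multiple zeta star values and the two power series) converge absolutely, and the right-hand side at $z=0$, where it has a removable singularity, is understood as its limit $1$. -/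

import Mathlib

/-- The index set of the series for `ζ⋆(s₁, …, s_r)`:
sequences of positive integers `k₁ ≥ k₂ ≥ ⋯ ≥ k_r ≥ 1`. -/
abbrev StarIndex (r : ℕ) : Type := {k : Fin r → ℕ+ // Antitone k}

/-- The summand `1 / (k₁ ^ s₁ ⋯ k_r ^ s_r)`. -/
noncomputable def zetaStarTerm (s : List ℕ) (k : StarIndex s.length) : ℝ :=
  1 / ∏ i : Fin s.length, ((k.1 i : ℕ) : ℝ) ^ s.get i

/-- The multiple zeta star value `ζ⋆(s₁, …, s_r)`; for the empty multi-index it is `1`. -/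
noncomputable def zetaStar (s : List ℕ) : ℝ := ∑' k : StarIndex s.length, zetaStarTerm s k

/-- The multi-index `{3, 1}^d`, i.e. `3, 1, 3, 1, …, 3, 1` with `d` repetitions. -/
def index31 (d : ℕ) : List ℕ := (List.replicate d [3, 1]).flatten

/-- The function `z ↦ tanh (π z / 2) · cot (π z / 2)` on `z ≠ 0`; its singularity at `0` is
removable, and its value there is the limit `1`. -/
noncomputable def tanhCot : ℂ → ℂ :=
  Function.update
    (fun z : ℂ => Complex.tanh (Real.pi * z / 2) * Complex.cot (Real.pi * z / 2)) 0 1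

/-!
Truncate the sums at `k₁ ≤ n` and let `X n` be the truncation of the left-hand side. Peeling off the
largest summation index, from the entries `3` and `1` in turn, gives a first-order linear recurrence
for `X` and a companion sequence `Y`. As `|z| < 1`, it has only one solution with `X 0 = 1` and
`Y 0 = 0`, and that solution is explicit:
`X n = 1 + ∑_{k ≤ n} n!² / ((n - k)! (n + k)!) * (P k - P (k - 1))`, where `P n` is the product over
`1 ≤ k ≤ n` of `(k² + (-1)^k z²) / (k² - (-1)^k z²)`. Since the weights are bounded by `1` and tend
to `1`, dominated convergence shows that `X` and `P` have the same limit, and Euler's product for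
the sine, split by the parity of `k`, evaluates it as `tanh (π z / 2) cot (π z / 2)`.
-/

open Filter Topology Finset Real

section Truncation

/-- The sequences `n ≥ k₁ ≥ ⋯ ≥ k_r ≥ 1`, over which the truncated series is summed. -/
noncomputable def starIndicesLE (r n : ℕ) : Finset (StarIndex r) :=
  open Classical in
  (Fintype.piFinset fun _ => (range n).map ⟨Nat.succPNat, Nat.succPNat_injective⟩).subtype Antitone

/-- The truncation `∑_{n ≥ k₁ ≥ ⋯ ≥ k_r ≥ 1} 1 / (k₁ ^ s₁ ⋯ k_r ^ s_r)` of `ζ⋆(s₁, …, s_r)`. -/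
noncomputable def starSum (s : List ℕ) (n : ℕ) : ℝ :=
  ∑ k ∈ starIndicesLE s.length n, zetaStarTerm s k

theorem mem_starIndicesLE {r n : ℕ} {k : StarIndex r} :
    k ∈ starIndicesLE r n ↔ ∀ i, (k.1 i : ℕ) ≤ n := by
  simp only [starIndicesLE, mem_subtype, Fintype.mem_piFinset, Finset.mem_map, mem_range]
  refine forall_congr' fun i => ⟨?_, fun h => ⟨(k.1 i).natPred, ?_, PNat.succPNat_natPred _⟩⟩
  · rintro ⟨m, hm, h⟩
    exact h ▸ hm
  · exact (Nat.pred_lt (k.1 i).ne_zero).trans_le h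

theorem starIndicesLE_mono (r : ℕ) : Monotone (starIndicesLE r) := fun _ _ hmn _ hk =>
  mem_starIndicesLE.2 fun i => (mem_starIndicesLE.1 hk i).trans hmn

theorem tendsto_starIndicesLE (r : ℕ) : Tendsto (starIndicesLE r) atTop atTop :=
  tendsto_atTop_finset_of_monotone (starIndicesLE_mono r) fun k =>
    ⟨∑ i, (k.1 i : ℕ), mem_starIndicesLE.2 fun i =>
      single_le_sum_of_canonicallyOrdered (f := fun i => (k.1 i : ℕ)) (mem_univ i)⟩

theorem zetaStarTerm_nonneg (s : List ℕ) (k : StarIndex s.length) : 0 ≤ zetaStarTerm s k := by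
  unfold zetaStarTerm
  positivity

theorem zetaStar_nonneg (s : List ℕ) : 0 ≤ zetaStar s := tsum_nonneg (zetaStarTerm_nonneg s)

theorem starSum_nonneg (s : List ℕ) (n : ℕ) : 0 ≤ starSum s n :=
  sum_nonneg fun _ _ => zetaStarTerm_nonneg _ _

variable {s : List ℕ} {B : ℝ}

theorem summable_zetaStarTerm (hB : ∀ n, starSum s n ≤ B) : Summable (zetaStarTerm s) := by
  refine summable_of_sum_le (c := B) (zetaStarTerm_nonneg s) fun u => ?_
  obtain ⟨n, hn⟩ := ((tendsto_starIndicesLE s.length).eventually_ge_atTop u).exists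
  exact (sum_le_sum_of_subset_of_nonneg hn fun _ _ _ => zetaStarTerm_nonneg _ _).trans (hB n)

theorem tendsto_starSum (hB : ∀ n, starSum s n ≤ B) :
    Tendsto (starSum s) atTop (𝓝 (zetaStar s)) :=
  (summable_zetaStarTerm hB).hasSum.comp (tendsto_starIndicesLE s.length)

theorem zetaStar_le (hB : ∀ n, starSum s n ≤ B) : zetaStar s ≤ B :=
  le_of_tendsto' (tendsto_starSum hB) hB

theorem starSum_nil (n : ℕ) : starSum [] n = 1 := by
  refine (sum_eq_single_of_mem (⟨Fin.elim0, fun i => i.elim0⟩ : StarIndex 0)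
    (mem_starIndicesLE.2 fun i => i.elim0) fun k _ hk =>
      absurd (Subsingleton.elim (α := StarIndex 0) _ _) hk).trans ?_
  simp [zetaStarTerm]

theorem antitone_cons_iff {α : Type*} [Preorder α] {r : ℕ} {a : α} {k : Fin r → α} :
    Antitone (Fin.cons a k : Fin (r + 1) → α) ↔ (∀ i, k i ≤ a) ∧ Antitone k := by
  simp [Antitone, Fin.forall_fin_succ]

theorem sum_starIndicesLE_succ {M : Type*} [AddCommMonoid M] {r : ℕ} (F : (Fin (r + 1) → ℕ+) → M)
    (n : ℕ) : ∑ k ∈ starIndicesLE (r + 1) n, F k.1 =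
      ∑ m ∈ range n, ∑ k ∈ starIndicesLE r (m + 1), F (Fin.cons m.succPNat k.1) := by
  rw [sum_sigma']
  symm
  refine sum_bij (fun p hp => ⟨Fin.cons p.1.succPNat p.2.1, antitone_cons_iff.2
    ⟨mem_starIndicesLE.1 (mem_sigma.1 hp).2, p.2.2⟩⟩) ?_ ?_ ?_ fun _ _ => rfl
  · rintro ⟨m, k⟩ hp
    obtain ⟨hm, hk⟩ := mem_sigma.1 hp
    exact mem_starIndicesLE.2 (Fin.forall_fin_succ.2 ⟨mem_range.1 hm,
      fun i => (mem_starIndicesLE.1 hk i).trans (mem_range.1 hm)⟩)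
  · rintro ⟨m, k⟩ _ ⟨m', k'⟩ _ h
    obtain ⟨hm, hk⟩ := Fin.cons_inj (α := fun _ => ℕ+) |>.1 (Subtype.ext_iff.1 h)
    obtain rfl := Nat.succPNat_injective hm
    obtain rfl := Subtype.ext hk
    rfl
  · rintro ⟨k, hk⟩ hkn
    obtain ⟨m, k, rfl⟩ : ∃ (m : ℕ) (k' : Fin r → ℕ+), k = Fin.cons m.succPNat k' :=
      ⟨(k 0).natPred, Fin.tail k, by rw [PNat.succPNat_natPred, Fin.cons_self_tail]⟩
    obtain ⟨hkm, hk⟩ := antitone_cons_iff.1 hk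
    exact ⟨⟨m, k, hk⟩, mem_sigma.2 ⟨mem_range.2 (mem_starIndicesLE.1 hkn 0),
      mem_starIndicesLE.2 hkm⟩, rfl⟩

theorem starSum_cons (a : ℕ) (s : List ℕ) (n : ℕ) :
    starSum (a :: s) n = ∑ m ∈ range n, starSum s (m + 1) / ((m : ℝ) + 1) ^ a := by
  simp only [starSum, sum_div]
  refine (sum_starIndicesLE_succ (r := s.length)
    (fun k => 1 / ∏ i, ((k i : ℕ) : ℝ) ^ (a :: s).get i) n).trans ?_
  refine sum_congr rfl fun m _ => sum_congr rfl fun k _ => ?_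
  rw [zetaStarTerm, Fin.prod_univ_succ, div_div, mul_comm]
  simp

theorem starSum_cons_zero (a : ℕ) (s : List ℕ) : starSum (a :: s) 0 = 0 := by
  rw [starSum_cons, sum_range_zero]

theorem starSum_cons_succ (a : ℕ) (s : List ℕ) (n : ℕ) :
    starSum (a :: s) (n + 1) = starSum (a :: s) n + starSum s (n + 1) / ((n : ℝ) + 1) ^ a := by
  simp only [starSum_cons, sum_range_succ]

end Truncation

section Bounds

variable {s : List ℕ}

theorem starSum_cons_le_mul {B : ℝ} (hB : ∀ n, starSum s n ≤ B) (a n : ℕ) :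
    starSum (a :: s) n ≤ n * B := by
  rw [starSum_cons]
  refine (sum_le_card_nsmul _ _ B fun m _ => ?_).trans_eq (by simp)
  exact (div_le_self (starSum_nonneg _ _) (one_le_pow₀ (by simp))).trans (hB _)

theorem starSum_succ_le (hs : ∀ a ∈ s, 1 ≤ a) (n : ℕ) : starSum s (n + 1) ≤ n + 1 := by
  induction s generalizing n with
  | nil => simp [starSum_nil]
  | cons a s ih =>
    obtain ⟨ha, hs⟩ := List.forall_mem_cons.1 hs
    rw [starSum_cons]
    refine (sum_le_card_nsmul _ _ 1 fun m _ => ?_).trans_eq (by simp)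
    rw [div_le_one (by positivity)]
    exact (ih hs m).trans (le_self_pow₀ (by simp) (by lia))

theorem sum_range_one_div_sq_le (n : ℕ) : ∑ m ∈ range n, 1 / ((m : ℝ) + 1) ^ 2 ≤ 2 := by
  have h := sum_Ioo_inv_sq_le (α := ℝ) 0 (n + 1)
  rw [← Finset.Ico_add_one_left_eq_Ioo] at h
  simpa [sum_Ico_eq_sum_range, add_comm] using h

theorem starSum_two_le (n : ℕ) : starSum [2] n ≤ 2 := by
  simpa only [starSum_cons, starSum_nil] using sum_range_one_div_sq_le n

theorem starSum_cons_le {a : ℕ} (ha : 3 ≤ a) (hs : ∀ b ∈ s, 1 ≤ b) (n : ℕ) :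
    starSum (a :: s) n ≤ 2 := by
  rw [starSum_cons]
  refine (sum_le_sum fun m _ => ?_).trans (sum_range_one_div_sq_le n)
  have h : (1 : ℝ) ≤ (m : ℝ) + 1 := by simp
  rw [div_le_div_iff₀ (by positivity) (by positivity), one_mul]
  calc starSum s (m + 1) * ((m : ℝ) + 1) ^ 2 ≤ ((m : ℝ) + 1) * ((m : ℝ) + 1) ^ 2 := by
        gcongr
        exact starSum_succ_le hs m
    _ = ((m : ℝ) + 1) ^ 3 := by ring
    _ ≤ ((m : ℝ) + 1) ^ a := pow_le_pow_right₀ h ha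

theorem index31_zero : index31 0 = [] := rfl

theorem index31_succ (d : ℕ) : index31 (d + 1) = 3 :: 1 :: index31 d := by
  simp [index31, List.replicate_succ]

theorem one_le_of_mem_index31 {a d : ℕ} (ha : a ∈ index31 d) : 1 ≤ a := by
  obtain ⟨l, hl, hal⟩ := List.mem_flatten.1 ha
  rw [List.eq_of_mem_replicate hl] at hal
  fin_cases hal <;> decide

theorem starSum_index31_append_le (hs : ∀ a ∈ s, 1 ≤ a) (hB : ∀ n, starSum s n ≤ 2) (d n : ℕ) :
    starSum (index31 d ++ s) n ≤ 2 := by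
  cases d with
  | zero => simpa [index31_zero] using hB n
  | succ d =>
    rw [index31_succ, List.cons_append]
    refine starSum_cons_le le_rfl (fun a ha => ?_) n
    rcases List.mem_cons.1 ha with rfl | ha
    · exact le_rfl
    · exact (List.mem_append.1 ha).elim one_le_of_mem_index31 (hs a)

end Bounds

section GeneratingFunctions

/-- The generating function `∑ S_n({3, 1}^d, t) w^d` of the truncated sums `S_n`. -/
noncomputable def genFun (t : List ℕ) (w : ℂ) (n : ℕ) : ℂ :=
  ∑' d : ℕ, (starSum (index31 d ++ t) n : ℂ) * w ^ d

/-- The generating function `∑ S_n(1, {3, 1}^d, t) w^d`, through which `genFun` is computed by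
recursion on the truncation `n`. -/
noncomputable def genFunOne (t : List ℕ) (w : ℂ) (n : ℕ) : ℂ :=
  ∑' d : ℕ, (starSum (1 :: (index31 d ++ t)) n : ℂ) * w ^ d

theorem norm_ofReal_mul_pow_le {a B : ℝ} (h₀ : 0 ≤ a) (h : a ≤ B) (w : ℂ) (d : ℕ) :
    ‖(a : ℂ) * w ^ d‖ ≤ B * ‖w‖ ^ d := by
  rw [norm_mul, norm_pow, Complex.norm_of_nonneg h₀]
  gcongr

theorem summable_mul_norm_pow (B : ℝ) {w : ℂ} (hw : ‖w‖ < 1) : Summable fun d => B * ‖w‖ ^ d :=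
  (summable_geometric_of_lt_one (norm_nonneg w) hw).mul_left B

theorem summable_ofReal_mul_pow {a : ℕ → ℝ} {B : ℝ} (h₀ : ∀ d, 0 ≤ a d) (h : ∀ d, a d ≤ B)
    {w : ℂ} (hw : ‖w‖ < 1) : Summable fun d => (a d : ℂ) * w ^ d :=
  .of_norm_bounded (summable_mul_norm_pow B hw) fun d => norm_ofReal_mul_pow_le (h₀ d) (h d) w d

theorem genFunOne_zero (t : List ℕ) (w : ℂ) : genFunOne t w 0 = 0 := by
  simp [genFunOne, starSum_cons_zero]

theorem genFun_zero (t : List ℕ) (w : ℂ) : genFun t w 0 = starSum t 0 := by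
  rw [genFun, tsum_eq_single 0]
  · simp [index31_zero]
  · intro d hd
    obtain ⟨d, rfl⟩ := Nat.exists_eq_succ_of_ne_zero hd
    simp [index31_succ, starSum_cons_zero]

variable {t : List ℕ} {B : ℝ} (hB : ∀ d n, starSum (index31 d ++ t) n ≤ B)
  {w : ℂ} (hw : ‖w‖ < 1)

include hB hw

theorem summable_genFun (n : ℕ) :
    Summable fun d => (starSum (index31 d ++ t) n : ℂ) * w ^ d :=
  summable_ofReal_mul_pow (fun _ => starSum_nonneg _ _) (fun d => hB d n) hw

theorem summable_genFunOne (n : ℕ) :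
    Summable fun d => (starSum (1 :: (index31 d ++ t)) n : ℂ) * w ^ d :=
  summable_ofReal_mul_pow (fun _ => starSum_nonneg _ _)
    (fun d => starSum_cons_le_mul (hB d) 1 n) hw

theorem genFunOne_succ (n : ℕ) :
    genFunOne t w (n + 1) = genFunOne t w n + genFun t w (n + 1) / (n + 1) := by
  simp only [genFunOne, genFun]
  rw [← tsum_div_const, ← (summable_genFunOne hB hw n).tsum_add
    ((summable_genFun hB hw (n + 1)).div_const _)]
  refine tsum_congr fun d => ?_
  rw [starSum_cons_succ]
  push_cast
  ring

theorem genFun_eq_add_tsum (n : ℕ) : genFun t w n = starSum t n +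
    ∑' d : ℕ, (starSum (3 :: 1 :: (index31 d ++ t)) n : ℂ) * w ^ (d + 1) := by
  rw [genFun, (summable_genFun hB hw n).tsum_eq_zero_add]
  simp [index31_zero, index31_succ]

theorem genFun_succ (n : ℕ) : genFun t w (n + 1) = genFun t w n +
    (starSum t (n + 1) - starSum t n) + w * genFunOne t w (n + 1) / (n + 1) ^ 3 := by
  have hs : Summable fun d => (starSum (3 :: 1 :: (index31 d ++ t)) n : ℂ) * w ^ (d + 1) :=
    ((summable_nat_add_iff 1).2 (summable_genFun hB hw n)).congr fun d => by simp [index31_succ]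
  have h : ∑' d, (starSum (3 :: 1 :: (index31 d ++ t)) (n + 1) : ℂ) * w ^ (d + 1) =
      ∑' d, (starSum (3 :: 1 :: (index31 d ++ t)) n : ℂ) * w ^ (d + 1) +
        w * genFunOne t w (n + 1) / (n + 1) ^ 3 := by
    rw [genFunOne, ← tsum_mul_left, ← tsum_div_const,
      ← hs.tsum_add (((summable_genFunOne hB hw (n + 1)).mul_left _).div_const _)]
    refine tsum_congr fun d => ?_
    rw [starSum_cons_succ]
    push_cast
    ring
  rw [genFun_eq_add_tsum hB hw, genFun_eq_add_tsum hB hw, h]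
  ring

theorem summable_zetaStar_mul_pow :
    Summable fun d => (zetaStar (index31 d ++ t) : ℂ) * w ^ d :=
  summable_ofReal_mul_pow (fun _ => zetaStar_nonneg _) (fun d => zetaStar_le (hB d)) hw

theorem tendsto_genFun :
    Tendsto (genFun t w) atTop (𝓝 (∑' d, (zetaStar (index31 d ++ t) : ℂ) * w ^ d)) :=
  tendsto_tsum_of_dominated_convergence (summable_mul_norm_pow B hw)
    (fun d => ((Complex.continuous_ofReal.tendsto _).comp (tendsto_starSum (hB d))).mul_const _)
    (.of_forall fun n d => norm_ofReal_mul_pow_le (starSum_nonneg _ _) (hB d n) w d)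

end GeneratingFunctions

section Recurrence

/-- The recurrence, solved for `(X (n + 1), Y (n + 1))` only implicitly, that links the generating
function `X n` of the truncated sums and its companion `Y n`. -/
structure IsSolution (z : ℂ) (X Y : ℕ → ℂ) : Prop where
  X_zero : X 0 = 1
  Y_zero : Y 0 = 0
  X_succ (n : ℕ) : X (n + 1) = X n + Y (n + 1) / (n + 1) ^ 3
  Y_succ (n : ℕ) : Y (n + 1) = Y n - z ^ 2 + z ^ 4 * X (n + 1) / (n + 1)

theorem natCast_add_one_pow_ne {w : ℂ} (hw : ‖w‖ < 1) (n m : ℕ) : ((n : ℂ) + 1) ^ m ≠ w := by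
  rintro rfl
  refine hw.not_ge ?_
  rw [norm_pow, ← Nat.cast_add_one, Complex.norm_natCast]
  exact one_le_pow₀ (by simp)

theorem norm_pow_lt_one {z : ℂ} (hz : ‖z‖ < 1) {m : ℕ} (hm : m ≠ 0) : ‖z ^ m‖ < 1 := by
  rw [norm_pow]
  exact pow_lt_one₀ (norm_nonneg z) hz hm

theorem IsSolution.unique {z : ℂ} (hz : ‖z‖ < 1) {X Y X' Y' : ℕ → ℂ} (h : IsSolution z X Y)
    (h' : IsSolution z X' Y') (n : ℕ) : X n = X' n ∧ Y n = Y' n := by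
  induction n with
  | zero => simp only [h.X_zero, h'.X_zero, h.Y_zero, h'.Y_zero, and_self]
  | succ n ih =>
    obtain ⟨hX, hY⟩ := ih
    have hn : (n : ℂ) + 1 ≠ 0 := n.cast_add_one_ne_zero
    have hX' : X (n + 1) - X' (n + 1) = (Y (n + 1) - Y' (n + 1)) / (n + 1) ^ 3 := by
      rw [h.X_succ, h'.X_succ, hX]
      ring
    have hY' : Y (n + 1) - Y' (n + 1) = z ^ 4 * (X (n + 1) - X' (n + 1)) / (n + 1) := by
      rw [h.Y_succ, h'.Y_succ, hY]
      ring
    have hne : ((n : ℂ) + 1) ^ 4 - z ^ 4 ≠ 0 :=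
      sub_ne_zero.2 (natCast_add_one_pow_ne (norm_pow_lt_one hz four_ne_zero) n 4)
    have hXX' : X (n + 1) - X' (n + 1) = 0 := by
      rw [hY'] at hX'
      refine (mul_eq_zero.1 ?_).resolve_left hne
      field_simp at hX'
      linear_combination hX'
    rw [hXX', mul_zero, zero_div] at hY'
    exact ⟨sub_eq_zero.1 hXX', sub_eq_zero.1 hY'⟩

theorem isSolution_genFun {z : ℂ} (hz : ‖z‖ < 1) :
    IsSolution z (fun n => genFun [] (z ^ 4) n - z ^ 2 * genFun [2] (z ^ 4) n)
      (fun n => z ^ 4 * (genFunOne [] (z ^ 4) n - z ^ 2 * genFunOne [2] (z ^ 4) n) -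
        n * z ^ 2) := by
  have hw := norm_pow_lt_one hz four_ne_zero
  have hnil := starSum_index31_append_le (s := []) (by simp) (by simp [starSum_nil])
  have htwo := starSum_index31_append_le (s := [2]) (by simp) starSum_two_le
  refine ⟨?_, ?_, fun n => ?_, fun n => ?_⟩
  · simp [genFun_zero, starSum_nil, starSum_cons_zero]
  · simp [genFunOne_zero]
  · have hn : (n : ℂ) + 1 ≠ 0 := n.cast_add_one_ne_zero
    rw [genFun_succ hnil hw, genFun_succ htwo hw, starSum_cons_succ]
    simp only [starSum_nil]
    push_cast
    field_simp
    ring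
  · rw [genFunOne_succ hnil hw, genFunOne_succ htwo hw]
    push_cast
    ring

end Recurrence

section Products

open Complex (I)

/-- The partial products of `∏ (k² - (-1)^(k-1) z²) / (k² + (-1)^(k-1) z²)`, over `k ≥ 1`. -/
noncomputable def altProd (z : ℂ) (n : ℕ) : ℂ :=
  ∏ k ∈ range n, ((k + 1) ^ 2 - (-1) ^ k * z ^ 2) / ((k + 1) ^ 2 + (-1) ^ k * z ^ 2)

theorem altProd_zero (z : ℂ) : altProd z 0 = 1 := prod_range_zero _

theorem norm_neg_one_pow_mul_sq_lt_one {z : ℂ} (hz : ‖z‖ < 1) (k : ℕ) :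
    ‖(-1) ^ k * z ^ 2‖ < 1 := by
  simpa using norm_pow_lt_one hz two_ne_zero

theorem altProd_succ {z : ℂ} (hz : ‖z‖ < 1) (k : ℕ) :
    altProd z (k + 1) * ((k + 1) ^ 2 + (-1) ^ k * z ^ 2) =
      altProd z k * ((k + 1) ^ 2 - (-1) ^ k * z ^ 2) := by
  have hne : ((k : ℂ) + 1) ^ 2 + (-1) ^ k * z ^ 2 ≠ 0 := by
    rw [← sub_neg_eq_add, sub_ne_zero]
    refine natCast_add_one_pow_ne ?_ k 2
    rw [norm_neg]
    exact norm_neg_one_pow_mul_sq_lt_one hz k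
  rw [altProd, prod_range_succ, ← altProd, mul_assoc, div_mul_cancel₀ _ hne]

theorem hasProd_sine {z : ℂ} (hz : z ≠ 0) :
    HasProd (fun n => 1 + sineTerm z n) (Complex.sin (π * z) / (π * z)) :=
  (multipliable_sineTerm z).hasProd_iff_tendsto_nat.2 (tendsto_euler_sin_prod' hz)

theorem multipliable_cosine (z : ℂ) :
    Multipliable fun k : ℕ => 1 + -z ^ 2 / (2 * k + 1 : ℂ) ^ 2 := by
  have hinj : Function.Injective fun k : ℕ => 2 * k := mul_right_injective₀ two_ne_zero
  refine multipliable_one_add_of_summable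
    (((summable_pow_div_add (z ^ 2) 2 1 one_lt_two).comp_injective hinj).congr fun k => ?_)
  simp

theorem sineTerm_two_mul_add_one (z : ℂ) (k : ℕ) :
    sineTerm z (2 * k + 1) = sineTerm (z / 2) k := by
  have hk : (k : ℂ) + 1 ≠ 0 := k.cast_add_one_ne_zero
  have hk' : 2 * (k : ℂ) + 1 + 1 ≠ 0 := by exact_mod_cast (2 * k + 1).succ_ne_zero
  simp only [sineTerm]
  push_cast
  field_simp
  ring

theorem hasProd_cosine {z : ℂ} (hz : z / 2 ∈ Complex.integerComplement) :
    HasProd (fun k : ℕ => 1 + -z ^ 2 / (2 * k + 1 : ℂ) ^ 2) (Complex.cos (π * z / 2)) := by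
  have h₀ : z / 2 ≠ 0 := Complex.integerComplement.ne_zero hz
  have hsin : Complex.sin (π * (z / 2)) ≠ 0 := sin_pi_mul_ne_zero hz
  have hπ : (π : ℂ) ≠ 0 := Complex.ofReal_ne_zero.2 Real.pi_ne_zero
  obtain ⟨c, hc⟩ := multipliable_cosine z
  have hsplit : HasProd (fun n => 1 + sineTerm z n)
      (c * (Complex.sin (π * (z / 2)) / (π * (z / 2)))) := by
    refine HasProd.even_mul_odd ?_ ?_
    · simpa [sineTerm] using hc
    · simpa only [sineTerm_two_mul_add_one] using hasProd_sine h₀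
  have hc' : Complex.cos (π * z / 2) = c := by
    have hdouble : π * z = 2 * (π * (z / 2)) := by ring
    have h := (hasProd_sine (div_ne_zero_iff.1 h₀).1).unique hsplit
    rw [hdouble, Complex.sin_two_mul] at h
    rw [mul_div_assoc]
    generalize hy : (π : ℂ) * (z / 2) = y at h hsin ⊢
    have hy₀ : y ≠ 0 := hy ▸ mul_ne_zero hπ h₀
    field_simp at h
    exact h
  rwa [hc']

/-- The factors of the infinite product for `cos (π z / 2) * sinh (π z / 2) / (π z / 2)`. -/
noncomputable def altSineFactor (z : ℂ) (k : ℕ) : ℂ := 1 - (-1) ^ k * z ^ 2 / (k + 1) ^ 2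

theorem altSineFactor_two_mul (z : ℂ) (k : ℕ) :
    altSineFactor z (2 * k) = 1 + -z ^ 2 / (2 * k + 1 : ℂ) ^ 2 := by
  simp [altSineFactor, sub_eq_add_neg, neg_div]

theorem altSineFactor_two_mul_add_one (z : ℂ) (k : ℕ) :
    altSineFactor z (2 * k + 1) = 1 + sineTerm (z / 2 * I) k := by
  rw [div_mul_eq_mul_div, ← sineTerm_two_mul_add_one, sineTerm, mul_pow, Complex.I_sq]
  simp [altSineFactor, pow_succ (-1 : ℂ), neg_div]

theorem hasProd_altSineFactor {z : ℂ} (hz : z / 2 ∈ Complex.integerComplement) :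
    HasProd (altSineFactor z)
      (Complex.cos (π * z / 2) * (Complex.sinh (π * z / 2) / (π * z / 2))) := by
  have h₀ : z / 2 ≠ 0 := Complex.integerComplement.ne_zero hz
  have hcos := hasProd_cosine hz
  have hodd := hasProd_sine (mul_ne_zero h₀ Complex.I_ne_zero)
  rw [← mul_assoc, Complex.sin_mul_I, mul_div_mul_right _ _ Complex.I_ne_zero] at hodd
  rw [mul_div_assoc] at hcos ⊢
  refine HasProd.even_mul_odd ?_ ?_
  · simpa only [altSineFactor_two_mul] using hcos
  · simpa only [altSineFactor_two_mul_add_one] using hodd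

theorem altProd_eq_prod_div_prod (z : ℂ) (n : ℕ) :
    altProd z n = (∏ k ∈ range n, altSineFactor z k) / ∏ k ∈ range n, altSineFactor (I * z) k := by
  rw [altProd, ← prod_div_distrib]
  refine prod_congr rfl fun k _ => ?_
  have hk : ((k : ℂ) + 1) ^ 2 ≠ 0 := pow_ne_zero 2 k.cast_add_one_ne_zero
  rw [altSineFactor, altSineFactor, mul_pow, Complex.I_sq, one_sub_div hk, one_sub_div hk,
    div_div_div_cancel_right₀ hk]
  ring

theorem mem_integerComplement_of_norm_lt_one {z : ℂ} (h₀ : z ≠ 0) (hz : ‖z‖ < 1) :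
    z ∈ Complex.integerComplement := by
  rintro ⟨n, rfl⟩
  rw [Complex.norm_intCast] at hz
  exact h₀ (by exact_mod_cast Int.abs_lt_one_iff.1 (by exact_mod_cast hz))

theorem div_two_mem_integerComplement {z : ℂ} (h₀ : z ≠ 0) (hz : ‖z‖ < 1) :
    z / 2 ∈ Complex.integerComplement := by
  refine mem_integerComplement_of_norm_lt_one (div_ne_zero h₀ two_ne_zero) ?_
  rw [norm_div, Complex.norm_ofNat]
  linarith [norm_nonneg z]

theorem sin_pi_mul_div_two_ne_zero {z : ℂ} (h₀ : z ≠ 0) (hz : ‖z‖ < 1) :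
    Complex.sin (π * z / 2) ≠ 0 := by
  rw [mul_div_assoc]
  exact sin_pi_mul_ne_zero (div_two_mem_integerComplement h₀ hz)

theorem cosh_pi_mul_div_two_ne_zero {z : ℂ} (h₀ : z ≠ 0) (hz : ‖z‖ < 1) :
    Complex.cosh (π * z / 2) ≠ 0 := by
  have hmem : I * z ∈ Complex.integerComplement :=
    mem_integerComplement_of_norm_lt_one (mul_ne_zero Complex.I_ne_zero h₀) (by simpa using hz)
  have hsin := sin_pi_mul_ne_zero hmem
  have hdouble : π * (I * z) = 2 * (π * z / 2 * I) := by ring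
  rw [hdouble, Complex.sin_two_mul, Complex.cos_mul_I] at hsin
  exact right_ne_zero_of_mul hsin

theorem pi_mul_div_two_ne_zero {z : ℂ} (h₀ : z ≠ 0) : (π : ℂ) * z / 2 ≠ 0 := by
  simp [h₀]

theorem tanhCot_of_ne_zero {z : ℂ} (h₀ : z ≠ 0) : tanhCot z =
    Complex.cos (π * z / 2) * (Complex.sinh (π * z / 2) / (π * z / 2)) /
      (Complex.cosh (π * z / 2) * (Complex.sin (π * z / 2) / (π * z / 2))) := by
  rw [tanhCot, Function.update_of_ne h₀, Complex.tanh_eq_sinh_div_cosh,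
    Complex.cot_eq_cos_div_sin]
  field_simp [pi_mul_div_two_ne_zero h₀]

theorem altProd_zero_left (n : ℕ) : altProd 0 n = 1 := by
  refine prod_eq_one fun k _ => ?_
  have hk : (k : ℂ) + 1 ≠ 0 := k.cast_add_one_ne_zero
  simp [hk]

theorem tendsto_altProd {z : ℂ} (hz : ‖z‖ < 1) : Tendsto (altProd z) atTop (𝓝 (tanhCot z)) := by
  rcases eq_or_ne z 0 with rfl | h₀
  · simp [funext altProd_zero_left, tanhCot]
  have hIz₀ : I * z ≠ 0 := mul_ne_zero Complex.I_ne_zero h₀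
  have hIz : ‖I * z‖ < 1 := by simpa using hz
  have hnum := (hasProd_altSineFactor (div_two_mem_integerComplement h₀ hz)).tendsto_prod_nat
  have hden := (hasProd_altSineFactor (div_two_mem_integerComplement hIz₀ hIz)).tendsto_prod_nat
  have hIy : π * (I * z) / 2 = π * z / 2 * I := by ring
  rw [hIy, Complex.cos_mul_I, Complex.sinh_mul_I, mul_div_mul_right _ _ Complex.I_ne_zero] at hden
  have hne : Complex.cosh (π * z / 2) * (Complex.sin (π * z / 2) / (π * z / 2)) ≠ 0 :=
    mul_ne_zero (cosh_pi_mul_div_two_ne_zero h₀ hz)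
      (div_ne_zero (sin_pi_mul_div_two_ne_zero h₀ hz) (pi_mul_div_two_ne_zero h₀))
  rw [tanhCot_of_ne_zero h₀]
  exact (hnum.div hden hne).congr fun n => (altProd_eq_prod_div_prod z n).symm

theorem summable_norm_altProd_sub {z : ℂ} (hz : ‖z‖ < 1) :
    Summable fun k => ‖altProd z (k + 1) - altProd z k‖ := by
  obtain ⟨M, hM⟩ := (tendsto_altProd hz).norm.bddAbove_range
  have hM (k : ℕ) : ‖altProd z k‖ ≤ M := hM ⟨k, rfl⟩
  refine .of_nonneg_of_le (fun _ => norm_nonneg _) (fun k => ?_)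
    (summable_pow_div_add ((2 * M : ℝ) : ℂ) 2 1 one_lt_two)
  have hk : ((k : ℂ) + 1) ^ 2 ≠ 0 := pow_ne_zero 2 k.cast_add_one_ne_zero
  have h : altProd z (k + 1) - altProd z k =
      -((-1) ^ k * z ^ 2) * (altProd z (k + 1) + altProd z k) / ((k : ℂ) + 1) ^ 2 := by
    rw [eq_div_iff hk]
    linear_combination altProd_succ hz k
  rw [h, norm_div, norm_div, norm_mul, norm_neg, Nat.cast_one]
  gcongr
  calc _ ≤ 1 * (‖altProd z (k + 1)‖ + ‖altProd z k‖) := by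
        gcongr
        · exact (norm_neg_one_pow_mul_sq_lt_one hz k).le
        · exact norm_add_le _ _
    _ ≤ 2 * M := by linarith [hM k, hM (k + 1)]
    _ ≤ ‖((2 * M : ℝ) : ℂ)‖ := (le_abs_self _).trans_eq (Complex.norm_real _).symm

end Products

section Weights

/-- The weight `n!² / ((n - k)! (n + k)!)`, encoded so that it vanishes for `k > n`. -/
noncomputable def centralWeight (n k : ℕ) : ℂ := n.descFactorial k / (n + 1).ascFactorial k

theorem centralWeight_zero_right (n : ℕ) : centralWeight n 0 = 1 := by
  simp [centralWeight]

theorem centralWeight_eq_zero {n k : ℕ} (h : n < k) : centralWeight n k = 0 := by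
  rw [centralWeight, Nat.descFactorial_eq_zero_iff_lt.2 h, Nat.cast_zero, zero_div]

theorem centralWeight_succ_right (n k : ℕ) :
    centralWeight n (k + 1) * (n + k + 1) = centralWeight n k * (n - k) := by
  rcases lt_or_ge n k with h | h
  · rw [centralWeight_eq_zero h, centralWeight_eq_zero (h.trans k.lt_succ_self), zero_mul,
      zero_mul]
  have hk : (n : ℂ) + 1 + k ≠ 0 := by exact_mod_cast (by lia : n + 1 + k ≠ 0)
  rw [centralWeight, centralWeight, Nat.descFactorial_succ, Nat.ascFactorial_succ]
  push_cast [h]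
  field_simp
  ring

theorem centralWeight_succ_left (n k : ℕ) :
    centralWeight (n + 1) k * ((n + 1) ^ 2 - k ^ 2) = centralWeight n k * (n + 1) ^ 2 := by
  induction k with
  | zero => simp [centralWeight_zero_right]
  | succ k ih =>
    have hn := centralWeight_succ_right n k
    have hn' := centralWeight_succ_right (n + 1) k
    have hk : (n : ℂ) + k + 1 ≠ 0 := by exact_mod_cast (n + k).succ_ne_zero
    push_cast at hn' ⊢
    refine mul_left_cancel₀ hk ?_
    linear_combination ((n : ℂ) + k + 1) * (n - k) * hn' - ((n : ℂ) + 1) ^ 2 * hn + (n - k) * ih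

theorem norm_centralWeight_le_one (n k : ℕ) : ‖centralWeight n k‖ ≤ 1 := by
  rw [centralWeight, norm_div, Complex.norm_natCast, Complex.norm_natCast]
  refine div_le_one_of_le₀ ?_ (Nat.cast_nonneg _)
  calc (n.descFactorial k : ℝ) ≤ (n ^ k : ℕ) := by exact_mod_cast Nat.descFactorial_le_pow n k
    _ ≤ ((n + 1) ^ k : ℕ) := by gcongr; lia
    _ ≤ (n + 1).ascFactorial k := by exact_mod_cast Nat.pow_succ_le_ascFactorial (n + 1) k

theorem tendsto_centralWeight (k : ℕ) : Tendsto (centralWeight · k) atTop (𝓝 1) := by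
  induction k with
  | zero => simp [centralWeight_zero_right]
  | succ k ih =>
    have hratio : Tendsto (fun n : ℕ => ((n : ℂ) - k) / (n + k + 1)) atTop (𝓝 1) := by
      have hinv := ((tendsto_add_atTop_iff_nat k).2
        (tendsto_one_div_add_atTop_nhds_zero_nat (𝕜 := ℂ))).const_mul (2 * (k : ℂ) + 1)
      have hlim := hinv.const_sub 1
      rw [mul_zero, sub_zero] at hlim
      refine hlim.congr fun n => ?_
      have hk : (n : ℂ) + k + 1 ≠ 0 := by exact_mod_cast (n + k).succ_ne_zero
      push_cast
      field_simp
      ring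
    have := ih.mul hratio
    rw [mul_one] at this
    refine this.congr fun n => ?_
    have hk : (n : ℂ) + k + 1 ≠ 0 := by exact_mod_cast (n + k).succ_ne_zero
    rw [← mul_div_assoc, ← centralWeight_succ_right, mul_div_cancel_right₀ _ hk]

end Weights

section ExplicitSolution

/-- The sum `1 + ∑_{1 ≤ k ≤ n} w_n(k) (P_k - P_{k-1})` with `w_n = centralWeight n` and
`P = altProd z`. -/
noncomputable def weightedSum (z : ℂ) (n : ℕ) : ℂ :=
  1 + ∑ k ∈ range n, centralWeight n (k + 1) * (altProd z (k + 1) - altProd z k)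

/-- The sum `∑_{1 ≤ k ≤ n} w_n(k) k² (P_k - P_{k-1})`, the companion of `weightedSum`. -/
noncomputable def weightedSumSq (z : ℂ) (n : ℕ) : ℂ :=
  ∑ k ∈ range n, centralWeight n (k + 1) * (k + 1) ^ 2 * (altProd z (k + 1) - altProd z k)

theorem sum_range_succ_centralWeight_mul (n : ℕ) (f : ℕ → ℂ) :
    ∑ k ∈ range (n + 1), centralWeight n (k + 1) * f k =
      ∑ k ∈ range n, centralWeight n (k + 1) * f k := by
  rw [sum_range_succ, centralWeight_eq_zero n.lt_succ_self, zero_mul, add_zero]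

theorem weightedSum_succ (z : ℂ) (n : ℕ) :
    weightedSum z (n + 1) = weightedSum z n + weightedSumSq z (n + 1) / (n + 1) ^ 2 := by
  have hn : (n : ℂ) + 1 ≠ 0 := n.cast_add_one_ne_zero
  rw [weightedSum, weightedSum, weightedSumSq, ← sum_range_succ_centralWeight_mul n, add_assoc,
    sum_div, ← sum_add_distrib]
  congr 1
  refine sum_congr rfl fun k _ => ?_
  have hk := centralWeight_succ_left n (k + 1)
  push_cast at hk
  field_simp
  linear_combination (altProd z (k + 1) - altProd z k) * hk

variable {z : ℂ} (hz : ‖z‖ < 1)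

include hz

/-- The summand is the forward difference in `k` of
`(N - k) w_N(k) P_k (-z⁴ + (-1)^k z² (N + k + k²))`, where `N = n + 1`. -/
theorem sum_centralWeight_mul_altProd_sub (n : ℕ) :
    ∑ k ∈ range (n + 1), centralWeight (n + 1) (k + 1) *
        ((k + 1) ^ 2 * ((n + 1) ^ 2 + n * (k + 1) ^ 2) - z ^ 4 * (n + 1)) *
        (altProd z (k + 1) - altProd z k) = (n + 1) * (z ^ 4 - z ^ 2 * (n + 1)) := by
  have h := sum_range_sub (fun k : ℕ => ((n : ℂ) + 1 - k) * centralWeight (n + 1) k * altProd z k *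
    (-z ^ 4 + (-1) ^ k * z ^ 2 * (n + 1 + k + k ^ 2))) (n + 1)
  simp only [centralWeight_zero_right, altProd_zero] at h
  refine (sum_congr rfl fun k _ => ?_).trans (h.trans ?_)
  · have hw := centralWeight_succ_right (n + 1) k
    have hP := altProd_succ hz k
    have hsign : ((-1 : ℂ) ^ k) ^ 2 = 1 := by rw [← pow_mul, mul_comm, pow_mul, neg_one_sq, one_pow]
    push_cast at hw ⊢
    rw [pow_succ (-1 : ℂ) k]
    linear_combination
      -centralWeight (n + 1) (k + 1) * (((k : ℂ) + 1) * ((-1) ^ k * z ^ 2) -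
        (((n : ℂ) + 1) ^ 2 + n * ((k : ℂ) + 1) ^ 2)) * hP -
      altProd z k * (-z ^ 4 + (-1) ^ k * z ^ 2 * (n + 1 + k + k ^ 2)) * hw +
      centralWeight (n + 1) (k + 1) * ((k : ℂ) + 1) * z ^ 4 *
        (altProd z (k + 1) + altProd z k) * hsign
  · push_cast
    ring

theorem weightedSumSq_succ (n : ℕ) : (n + 1) * weightedSumSq z (n + 1) =
    n * weightedSumSq z n - z ^ 2 + z ^ 4 * weightedSum z (n + 1) / (n + 1) := by
  have hn : (n : ℂ) + 1 ≠ 0 := n.cast_add_one_ne_zero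
  have hsq : weightedSumSq z n = ∑ k ∈ range (n + 1),
      centralWeight n (k + 1) * ((k + 1) ^ 2 * (altProd z (k + 1) - altProd z k)) := by
    simp only [weightedSumSq, mul_assoc, sum_range_succ_centralWeight_mul]
  have hsum : ∑ k ∈ range (n + 1), centralWeight (n + 1) (k + 1) *
        ((k + 1) ^ 2 * ((n + 1) ^ 2 + n * (k + 1) ^ 2) - z ^ 4 * (n + 1)) *
        (altProd z (k + 1) - altProd z k) =
      (n + 1) ^ 3 * weightedSumSq z (n + 1) - n * (n + 1) ^ 2 * weightedSumSq z n -
        z ^ 4 * (n + 1) * (weightedSum z (n + 1) - 1) := by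
    rw [hsq, weightedSumSq, weightedSum, add_sub_cancel_left, mul_sum, mul_sum, mul_sum,
      ← sum_sub_distrib, ← sum_sub_distrib]
    refine sum_congr rfl fun k _ => ?_
    have hk := centralWeight_succ_left n (k + 1)
    push_cast at hk
    linear_combination (-n * ((k : ℂ) + 1) ^ 2 * (altProd z (k + 1) - altProd z k)) * hk
  rw [sum_centralWeight_mul_altProd_sub hz] at hsum
  field_simp
  refine mul_left_cancel₀ hn ?_
  linear_combination -hsum

theorem isSolution_weightedSum :
    IsSolution z (weightedSum z) (fun n => n * weightedSumSq z n) where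
  X_zero := by simp [weightedSum]
  Y_zero := by simp
  X_succ n := by
    have hn : (n : ℂ) + 1 ≠ 0 := n.cast_add_one_ne_zero
    rw [weightedSum_succ]
    push_cast
    field_simp
  Y_succ n := by exact_mod_cast weightedSumSq_succ hz n

theorem tsum_altProd_sub : ∑' k, (altProd z (k + 1) - altProd z k) = tanhCot z - 1 := by
  refine tendsto_nhds_unique (summable_norm_altProd_sub hz).of_norm.hasSum.tendsto_sum_nat ?_
  simp only [sum_range_sub, altProd_zero]
  exact (tendsto_altProd hz).sub_const 1

theorem tendsto_weightedSum : Tendsto (weightedSum z) atTop (𝓝 (tanhCot z)) := by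
  have hdom : Tendsto
      (fun n => ∑' k, centralWeight n (k + 1) * (altProd z (k + 1) - altProd z k)) atTop
      (𝓝 (∑' k, (altProd z (k + 1) - altProd z k))) := by
    refine tendsto_tsum_of_dominated_convergence (summable_norm_altProd_sub hz) (fun k => ?_)
      (.of_forall fun n k => ?_)
    · simpa only [one_mul] using (tendsto_centralWeight (k + 1)).mul_const
        (altProd z (k + 1) - altProd z k)
    · rw [norm_mul]
      exact mul_le_of_le_one_left (norm_nonneg _) (norm_centralWeight_le_one _ _)
  rw [tsum_altProd_sub hz] at hdom
  have hlim := hdom.const_add 1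
  rw [add_sub_cancel] at hlim
  refine hlim.congr fun n => ?_
  rw [weightedSum, tsum_eq_sum (s := range n)]
  intro k hk
  rw [centralWeight_eq_zero (Nat.lt_succ_of_le (by simpa using hk)), zero_mul]

end ExplicitSolution

section RemovableSingularity

theorem tendsto_sin_div_self : Tendsto (fun y : ℂ => Complex.sin y / y) (𝓝[≠] 0) (𝓝 1) := by
  simpa [slope_fun_def, div_eq_inv_mul] using
    hasDerivAt_iff_tendsto_slope.1 (Complex.hasDerivAt_sin 0)

theorem tendsto_sinh_div_self : Tendsto (fun y : ℂ => Complex.sinh y / y) (𝓝[≠] 0) (𝓝 1) := by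
  simpa [slope_fun_def, div_eq_inv_mul] using
    hasDerivAt_iff_tendsto_slope.1 (Complex.hasDerivAt_sinh 0)

theorem tendsto_tanh_mul_cot :
    Tendsto (fun y : ℂ => Complex.tanh y * Complex.cot y) (𝓝[≠] 0) (𝓝 1) := by
  have hcos : Tendsto (fun y : ℂ => Complex.cos y / Complex.cosh y) (𝓝[≠] 0) (𝓝 1) := by
    have : ContinuousAt (fun y : ℂ => Complex.cos y / Complex.cosh y) 0 :=
      Complex.continuous_cos.continuousAt.div Complex.continuous_cosh.continuousAt (by simp)
    simpa using this.tendsto.mono_left nhdsWithin_le_nhds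
  have h := (tendsto_sinh_div_self.div tendsto_sin_div_self one_ne_zero).mul hcos
  rw [div_one, mul_one] at h
  refine h.congr' (eventually_mem_nhdsWithin.mono fun y (hy : y ≠ 0) => ?_)
  beta_reduce
  rw [Pi.div_apply, div_div_div_cancel_right₀ hy, Complex.tanh_eq_sinh_div_cosh,
    Complex.cot_eq_cos_div_sin]
  ring

theorem tendsto_pi_mul_div_two : Tendsto (fun z : ℂ => π * z / 2) (𝓝[≠] 0) (𝓝[≠] 0) := by
  have hcont : Continuous fun z : ℂ => π * z / 2 := by fun_prop
  refine tendsto_nhdsWithin_iff.2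
    ⟨by simpa using (hcont.tendsto 0).mono_left nhdsWithin_le_nhds, ?_⟩
  exact eventually_mem_nhdsWithin.mono fun z => pi_mul_div_two_ne_zero

end RemovableSingularity

theorem theorem2p3 :
    (∀ d : ℕ, Summable (zetaStarTerm (index31 d)) ∧
      Summable (zetaStarTerm (index31 d ++ [2]))) ∧
    Filter.Tendsto
      (fun z : ℂ => Complex.tanh (Real.pi * z / 2) * Complex.cot (Real.pi * z / 2))
      (nhdsWithin 0 {0}ᶜ) (nhds 1) ∧
    ∀ z : ℂ, ‖z‖ < 1 →
      Summable (fun d : ℕ => (zetaStar (index31 d) : ℂ) * z ^ (4 * d)) ∧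
      Summable (fun d : ℕ => (zetaStar (index31 d ++ [2]) : ℂ) * z ^ (4 * d + 2)) ∧
      (∑' d : ℕ, (zetaStar (index31 d) : ℂ) * z ^ (4 * d)) -
          ∑' d : ℕ, (zetaStar (index31 d ++ [2]) : ℂ) * z ^ (4 * d + 2) =
        tanhCot z := by
  have hnil := starSum_index31_append_le (s := []) (by simp) (by simp [starSum_nil])
  have htwo := starSum_index31_append_le (s := [2]) (by simp) starSum_two_le
  refine ⟨fun d => ⟨index31 d |>.append_nil ▸ summable_zetaStarTerm (hnil d),
    summable_zetaStarTerm (htwo d)⟩, tendsto_tanh_mul_cot.comp tendsto_pi_mul_div_two,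
    fun z hz => ?_⟩
  have hw := norm_pow_lt_one hz four_ne_zero
  have hsum := summable_zetaStar_mul_pow hnil hw
  have hlim := (tendsto_genFun hnil hw).sub ((tendsto_genFun htwo hw).const_mul (z ^ 2))
  simp only [List.append_nil] at hsum hlim
  simp only [pow_add, pow_mul, ← mul_assoc]
  refine ⟨hsum, (summable_zetaStar_mul_pow htwo hw).mul_right _, ?_⟩
  rw [tsum_mul_right, mul_comm _ (z ^ 2)]
  refine tendsto_nhds_unique hlim ((tendsto_weightedSum hz).congr fun n => ?_)
  exact ((isSolution_weightedSum hz).unique hz (isSolution_genFun hz) n).1
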